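/- Let $G$ be a finite connected graph with at least one edge (loops and multiple edges allowed), embedded in a closed connected oriented surface so that every face is an open disk. Fix a reference orientation of the edges, so that every oriented subgraph $T$ has a characteristic flow $\phi(T)\in\mathbb{Z}^{E}$ with $\phi(T)_e=+1$ (resp. $-1$, $0$) if $T$ contains $e$ in its reference direction (resp. in the opposite direction, not at all). For a face $F$ let $\phi(F)\in\mathbb{Z}^{E}$ be the flow of its counterclockwise facial walk (the walk along $F$ that has $F$ on its left; $\phi(F)_e$ is the number of forward minus the number of backward traversals of $e$), and let $\mathbb{F}\subseteq\mathbb{Z}^{E}$ be the subgroup generated by these flows. Two orientations $D,D'$ of $G$ are homologous if $\phi(D)-\phi(D')\in\mathbb{F}$. Let $D_0$ be an orientation of $G$, let $f_0$ be a face of $G$, and let $O(G,D_0)$ be the set of all orientations of $G$ homologous to $D_0$. For $D,D'\in O(G,D_0)$ write $D\le_{f_0}D'$ if $\phi(D\setminus D')=\sum_{F\ne f_0}\lambda_F\,\phi(F)$ for some $\lambda_F\in\mathbb{N}$ (with $0\in\mathbb{N}$), where $D\setminus D'$ is the oriented subgraph of $D$ formed by the edges that $D'$ orients differently. An edge is rigid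 if it has the same orientation in all elements of $O(G,D_0)$. Let $\widetilde G$ be the embedded graph obtained from $G$ by deleting all rigid edges, let $\widetilde f_0$ be the face of $\widetilde G$ (connected component of the complement of $\widetilde G$) that contains $f_0$, and let $\widetilde F_0$ be its counterclockwise boundary, that is, the oriented subgraph formed by the edges of $\widetilde G$ incident to $\widetilde f_0$, each directed with $\widetilde f_0$ on its left. Let $-\widetilde F_0$ be the oriented subgraph obtained by reversing all edges of $\widetilde F_0$. Then $(O(G,D_0),\le_{f_0})$ has a unique maximum $D_{\max}$ and a unique minimum $D_{\min}$; $\widetilde F_0$ is an oriented subgraph of $D_{\max}$, and $-\widetilde F_0$ is an oriented subgraph of $D_{\min}$. -/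

import Mathlib

/-- A finite map on a closed connected oriented surface, given as a combinatorial map
(rotation system). `E` is the set of edges, each of which carries a reference orientation.
The two darts of the edge `e` are `(e, true)` (`e` traversed forward) and `(e, false)`
(`e` traversed backward). `rot d` is the dart that follows `d` in counterclockwise order around
the tail of `d`, so the vertices are the cycles of `rot`. Loops and multiple edges are allowed. -/
structure SurfaceMap (E : Type*) where
  /-- the counterclockwise rotation of the darts around their tails -/
  rot : Equiv.Perm (E × Bool)
  /-- the map is connected: `rot` and the reversal of darts generate a transitive group -/
  connected : ∀ d d' : E × Bool,
    ∃ g ∈ Subgroup.closure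
      {rot, Equiv.prodCongr (Equiv.refl E) (Equiv.boolNot : Equiv.Perm Bool)}, g d = d'

namespace SurfaceMap

/-- The reversal of darts. -/
def rev {E : Type*} : Equiv.Perm (E × Bool) :=
  Equiv.prodCongr (Equiv.refl E) Equiv.boolNot

/-- An orientation of the edges: `D e` is `true` if `e` is directed as in the reference
orientation, and `false` if it is directed the other way. -/
abbrev EdgeOrientation (E : Type*) := E → Bool

/-- An oriented subgraph, that is, a set of walks of unit length. -/
abbrev OrientedSubgraph (E : Type*) := Set (E × Bool)

/-- An orientation as an oriented subgraph: the darts that are directed as `D` prescribes. -/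
def darts {E : Type*} (D : EdgeOrientation E) : OrientedSubgraph E :=
  {d | D d.1 = d.2}

open Classical in
/-- The characteristic flow of an oriented subgraph, a vector of `ℤ ^ E`. -/
noncomputable def flow {E : Type*} (T : OrientedSubgraph E) : E → ℤ := fun e =>
  (if (e, true) ∈ T then 1 else 0) - (if (e, false) ∈ T then 1 else 0)

variable {E : Type*} (G : SurfaceMap E)

/-- The dart that follows `d` on the facial walk of the face to the left of `d`: arriving at the
head of `d`, continue with the dart just before the reversal of `d` in counterclockwise order. -/
def faceNext : Equiv.Perm (E × Bool) := G.rot⁻¹ * rev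

/-- The faces of the map: the cycles of `faceNext`. -/
def Face : Type _ := Quotient (Equiv.Perm.SameCycle.setoid G.faceNext)

/-- The face on the left of a dart. -/
def leftFace (d : E × Bool) : G.Face := Quotient.mk _ d

instance [Finite E] : Finite G.Face :=
  inferInstanceAs (Finite (Quotient (Equiv.Perm.SameCycle.setoid G.faceNext)))

noncomputable instance [Finite E] : Fintype G.Face := Fintype.ofFinite _

/-- The characteristic flow of the counterclockwise facial walk of `f`. This walk traverses each
dart having `f` on its left exactly once, and no other dart. -/
noncomputable def faceFlow (f : G.Face) : E → ℤ := flow {d | G.leftFace d = f}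

/-- Two flows are homologous if their difference lies in the subgroup generated by the
counterclockwise facial walks. -/
def Homologous (p q : E → ℤ) : Prop :=
  p - q ∈ AddSubgroup.closure (Set.range G.faceFlow)

/-- A counterclockwise oriented subgraph (with respect to `f₀`): its characteristic flow is a
combination, with natural numbers as coefficients, of the counterclockwise facial walks of the
faces other than `f₀`. -/
def IsCounterclockwise [Finite E] (f₀ : G.Face) (T : OrientedSubgraph E) : Prop :=
  ∃ c : G.Face → ℕ, c f₀ = 0 ∧ flow T = ∑ f, c f • G.faceFlow f

/-- The set of the orientations that are homologous to `D₀`. The face `f₀` is a parameter because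
the order below depends on it. -/
@[nolint unusedArguments]
def HomologousOrientations (D₀ : EdgeOrientation E) (_f₀ : G.Face) : Type _ :=
  {D : EdgeOrientation E // G.Homologous (flow (darts D)) (flow (darts D₀))}

/-- `D ≤ D'` if and only if `D \ D'` is counterclockwise with respect to `f₀`. -/
instance [Finite E] (D₀ : EdgeOrientation E) (f₀ : G.Face) :
    LE (G.HomologousOrientations D₀ f₀) :=
  ⟨fun D D' => G.IsCounterclockwise f₀ (darts D.1 \ darts D'.1)⟩

/-- An edge is rigid if it has the same orientation in all the orientations homologous to `D₀`. -/
def IsRigid (D₀ : EdgeOrientation E) (e : E) : Prop :=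
  ∀ D D' : EdgeOrientation E, G.Homologous (flow (darts D)) (flow (darts D₀)) →
    G.Homologous (flow (darts D')) (flow (darts D₀)) → D e = D' e

/-- The faces of the embedded graph obtained from `G` by deleting the edges not in `S`. Deleting
an edge merges the faces on its two sides, so these faces (the connected components of the
complement of the remaining graph, not necessarily disks) are the classes of faces of `G` under
the equivalence relation generated by being on the two sides of a deleted edge. -/
def SubFace (S : Set E) : Type _ :=
  Quot fun f f' : G.Face => ∃ d : E × Bool, d.1 ∉ S ∧ G.leftFace d = f ∧ G.leftFace (rev d) = f'

/-- The face, of the graph with edge set `S`, that contains the face `f` of `G`. -/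
def subFaceOf (S : Set E) (f : G.Face) : G.SubFace S := Quot.mk _ f

/-- The counterclockwise boundary of a face `g` of the graph with edge set `S`: the edges of this
graph that are incident to `g`, directed with `g` on their left. -/
def subBoundary (S : Set E) (g : G.SubFace S) : OrientedSubgraph E :=
  {d | d.1 ∈ S ∧ G.subFaceOf S (G.leftFace d) = g}

/-- The counterclockwise boundary of the special face: delete all rigid edges from `G`, and take
the face that contains `f₀`. -/
def specialBoundary (D₀ : EdgeOrientation E) (f₀ : G.Face) : OrientedSubgraph E :=
  G.subBoundary {e | ¬ G.IsRigid D₀ e} (G.subFaceOf _ f₀)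

/-- The oriented subgraph with every edge reversed. -/
def reverse {E : Type*} (T : OrientedSubgraph E) : OrientedSubgraph E := {d | rev d ∈ T}

end SurfaceMap

namespace SurfaceMap

/-! Integer combinations of facial walks are the coboundaries of functions on the faces. Hence each
orientation homologous to `D₀` is encoded by a unique potential vanishing at `f₀`, and the order
becomes the reversed pointwise order of potentials (`isCounterclockwise_diff_iff`). Potentials are
closed under pointwise `⊓` and `⊔` (`IsPotential.exists_inf_or_sup`), so finiteness gives both
extremes. All potentials vanish on the special face. Reversing an edge of its boundary therefore
changes the potential just across that edge, with a sign fixed by the direction of the edge;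
extremality forces this direction. -/

theorem flow_darts {E : Type*} (D : EdgeOrientation E) (e : E) :
    flow (darts D) e = if D e then 1 else -1 := by
  cases h : D e <;> simp [flow, darts, h]

theorem two_mul_flow_darts_diff {E : Type*} (D D' : EdgeOrientation E) (e : E) :
    2 * flow (darts D \ darts D') e = flow (darts D) e - flow (darts D') e := by
  cases h : D e <;> cases h' : D' e <;> simp [flow, darts, h, h']

theorem exists_edgeOrientation_flow_eq {E : Type*} (p : E → ℤ)
    (hp : ∀ e, p e = 1 ∨ p e = -1) : ∃ D : EdgeOrientation E, flow (darts D) = p := by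
  refine ⟨fun e => decide (p e = 1), funext fun e => ?_⟩
  rcases hp e with h | h <;> simp [flow_darts, h]

theorem flow_darts_eq_or {E : Type*} (D : EdgeOrientation E) (e : E) :
    flow (darts D) e = 1 ∨ flow (darts D) e = -1 := by
  cases h : D e <;> simp [flow_darts, h]

theorem flow_darts_injective {E : Type*} :
    Function.Injective fun D : EdgeOrientation E => flow (darts D) := by
  intro D D' h
  funext e
  have h' := congrFun h e
  simp only [flow_darts] at h'
  cases hD : D e <;> cases hD' : D' e <;> simp_all

/-! ### Coboundaries, connectedness of the dual graph, potentials -/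

variable {E : Type*} (G : SurfaceMap E)

/-- The difference of a potential on the faces across each edge: left side minus right side. -/
def coboundary : (G.Face → ℤ) →+ (E → ℤ) where
  toFun x e := x (G.leftFace (e, true)) - x (G.leftFace (e, false))
  map_zero' := by ext; simp
  map_add' x y := by ext; simp; ring

theorem coboundary_apply (x : G.Face → ℤ) (e : E) :
    G.coboundary x e = x (G.leftFace (e, true)) - x (G.leftFace (e, false)) := rfl

/-- Only the faces on the two sides of an edge contribute to its coordinate, with opposite signs;
they cancel if the two faces coincide. -/
theorem sum_smul_faceFlow [Finite E] (x : G.Face → ℤ) :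
    ∑ f, x f • G.faceFlow f = G.coboundary x := by
  classical
  ext e
  simp [coboundary_apply, faceFlow, flow, mul_sub, Finset.sum_sub_distrib]

theorem homologous_iff [Finite E] (p q : E → ℤ) :
    G.Homologous p q ↔ ∃ x, p - q = G.coboundary x := by
  constructor
  · intro h
    have hle : AddSubgroup.closure (Set.range G.faceFlow) ≤ G.coboundary.range := by
      classical
      rw [AddSubgroup.closure_le]
      rintro _ ⟨f, rfl⟩
      refine ⟨Pi.single f 1, ?_⟩
      rw [← sum_smul_faceFlow]
      simp [Pi.single_apply]
    obtain ⟨x, hx⟩ := hle h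
    exact ⟨x, hx.symm⟩
  · rintro ⟨x, hx⟩
    rw [Homologous, hx, ← sum_smul_faceFlow]
    exact sum_mem fun f _ => AddSubgroup.zsmul_mem _
      (AddSubgroup.subset_closure (Set.mem_range_self f)) _

theorem leftFace_rot (d : E × Bool) : G.leftFace (rev (G.rot d)) = G.leftFace d := by
  have h : rev (rev (G.rot d)) = G.rot d := by
    obtain ⟨e, b⟩ := G.rot d
    simp [rev]
  have hcycle : G.faceNext.SameCycle (rev (G.rot d)) d := ⟨1, by
    rw [zpow_one, faceNext, Equiv.Perm.mul_apply, h, ← Equiv.Perm.mul_apply, inv_mul_cancel,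
      Equiv.Perm.one_apply]⟩
  exact Quotient.sound hcycle

/-- The dual graph is connected: a function on the faces that agrees on the two sides of each
edge is constant. -/
theorem eq_of_forall_leftFace_eq {α : Type*} (x : G.Face → α)
    (hx : ∀ e, x (G.leftFace (e, true)) = x (G.leftFace (e, false))) (f f' : G.Face) :
    x f = x f' := by
  have hrev : ∀ d : E × Bool, x (G.leftFace (rev d)) = x (G.leftFace d) := by
    rintro ⟨e, b⟩
    cases b
    · exact hx e
    · exact (hx e).symm
  have key : ∀ g ∈ Subgroup.closure
      {G.rot, Equiv.prodCongr (Equiv.refl E) (Equiv.boolNot : Equiv.Perm Bool)},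
      ∀ d, x (G.leftFace (g d)) = x (G.leftFace d) := by
    intro g hg
    induction hg using Subgroup.closure_induction with
    | mem g hg =>
      intro d
      rcases hg with rfl | rfl
      · rw [← hrev, leftFace_rot]
      · exact hrev d
    | one => simp
    | mul g h _ _ ihg ihh => intro d; rw [Equiv.Perm.mul_apply, ihg, ihh]
    | inv g _ ih => intro d; rw [← ih, ← Equiv.Perm.mul_apply, mul_inv_cancel, Equiv.Perm.one_apply]
  induction f using Quotient.inductionOn with | h d
  induction f' using Quotient.inductionOn with | h d'
  obtain ⟨g, hg, rfl⟩ := G.connected d d'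
  exact (key g hg d).symm

theorem eq_of_coboundary_eq (f₀ : G.Face) {x y : G.Face → ℤ} (h₀ : x f₀ = y f₀)
    (h : G.coboundary x = G.coboundary y) : x = y := by
  funext f
  have := G.eq_of_forall_leftFace_eq (fun f => x f - y f) (fun e => by
    have := congrFun h e
    simp only [coboundary_apply] at this
    linarith) f f₀
  linarith

/-- `x` is the potential of `D` relative to `D₀`, normalized to vanish at `f₀`. -/
def IsPotential (D₀ : EdgeOrientation E) (f₀ : G.Face) (D : EdgeOrientation E)
    (x : G.Face → ℤ) : Prop :=
  x f₀ = 0 ∧ ∀ e, flow (darts D) e - flow (darts D₀) e = 2 * G.coboundary x e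

theorem homologous_darts_iff_exists_isPotential [Finite E] (D₀ D : EdgeOrientation E)
    (f₀ : G.Face) :
    G.Homologous (flow (darts D)) (flow (darts D₀)) ↔ ∃ x, G.IsPotential D₀ f₀ D x := by
  rw [homologous_iff]
  constructor
  · rintro ⟨y, hy⟩
    have hdiff : ∀ e, 2 * flow (darts D \ darts D₀) e =
        y (G.leftFace (e, true)) - y (G.leftFace (e, false)) := fun e => by
      rw [two_mul_flow_darts_diff, ← coboundary_apply, ← hy, Pi.sub_apply]
    -- The coboundary of `y` is even, so `y` has the same parity on all faces, and `y f - y f₀` can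
    -- be halved exactly.
    have hmod := fun f => G.eq_of_forall_leftFace_eq (fun f => y f % 2)
      (fun e => by have := hdiff e; omega) f f₀
    refine ⟨fun f => (y f - y f₀) / 2, by simp, ?_⟩
    intro e
    have h₀ := hdiff e
    rw [two_mul_flow_darts_diff] at h₀
    have h₁ := hmod (G.leftFace (e, true))
    have h₂ := hmod (G.leftFace (e, false))
    rw [coboundary_apply]
    omega
  · rintro ⟨x, -, hx⟩
    exact ⟨2 • x, funext fun e => by simp [hx e, map_nsmul, -nsmul_eq_mul]⟩

/-! ### The lattice of potentials -/

variable {G} {D₀ : EdgeOrientation E} {f₀ : G.Face}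

theorem IsPotential.flow_sub {D D' : EdgeOrientation E} {x x' : G.Face → ℤ}
    (h : G.IsPotential D₀ f₀ D x) (h' : G.IsPotential D₀ f₀ D' x') (e : E) :
    flow (darts D) e - flow (darts D') e =
      2 * ((x - x') (G.leftFace (e, true)) - (x - x') (G.leftFace (e, false))) := by
  have h₁ := h.2 e
  have h₂ := h'.2 e
  simp only [Pi.sub_apply, coboundary_apply] at h₁ h₂ ⊢
  linarith

/-- Being a potential means, edge by edge, that the left value minus the right value lies in `{0,
-1}` or in `{0, 1}`, depending on `D₀`. Such difference constraints survive pointwise minima and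
maxima. -/
theorem IsPotential.exists_inf_or_sup {D D' : EdgeOrientation E} {x x' z : G.Face → ℤ}
    (h : G.IsPotential D₀ f₀ D x) (h' : G.IsPotential D₀ f₀ D' x')
    (hz : z = x ⊓ x' ∨ z = x ⊔ x') : ∃ D'', G.IsPotential D₀ f₀ D'' z := by
  obtain ⟨D'', hD''⟩ := exists_edgeOrientation_flow_eq
    (fun e => flow (darts D₀) e + 2 * G.coboundary z e) (fun e => by
      have h₁ := h.2 e
      have h₂ := h'.2 e
      have o := flow_darts_eq_or D e
      have o' := flow_darts_eq_or D' e
      have o₀ := flow_darts_eq_or D₀ e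
      rw [coboundary_apply] at h₁ h₂ ⊢
      rcases hz with rfl | rfl
      · simp only [Pi.inf_apply]
        omega
      · simp only [Pi.sup_apply]
        omega)
  refine ⟨D'', ?_, fun e => by rw [hD'']; ring⟩
  rcases hz with rfl | rfl <;> simp [h.1, h'.1]

theorem isCounterclockwise_diff_iff [Finite E] {D D' : EdgeOrientation E} {x x' : G.Face → ℤ}
    (h : G.IsPotential D₀ f₀ D x) (h' : G.IsPotential D₀ f₀ D' x') :
    G.IsCounterclockwise f₀ (darts D \ darts D') ↔ x' ≤ x := by
  have hflow : flow (darts D \ darts D') = G.coboundary (x - x') := by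
    ext e
    have h₁ := two_mul_flow_darts_diff D D' e
    rw [h.flow_sub h' e] at h₁
    exact mul_left_cancel₀ two_ne_zero h₁
  have hsum : ∀ c : G.Face → ℕ, ∑ f, c f • G.faceFlow f = G.coboundary fun f => (c f : ℤ) :=
    fun c => by simp [← sum_smul_faceFlow]
  constructor
  · rintro ⟨c, hc₀, hc⟩ f
    have : x - x' = fun f => (c f : ℤ) := G.eq_of_coboundary_eq f₀ (by simp [h.1, h'.1, hc₀])
      (by rw [← hsum, ← hc, hflow])
    have := congrFun this f
    simp only [Pi.sub_apply] at this
    linarith [(c f).cast_nonneg (α := ℤ)]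
  · intro hle
    refine ⟨fun f => (x f - x' f).toNat, by simp [h.1, h'.1], ?_⟩
    rw [hsum, hflow]
    congr 1
    funext f
    exact (Int.toNat_of_nonneg (sub_nonneg.2 (hle f))).symm

/-! ### The special face -/

/-- On the face of the graph of non-rigid edges that contains `f₀`, all potentials agree. -/
theorem IsPotential.eq_zero_of_subFaceOf_eq [Finite E] {D D' : EdgeOrientation E}
    {x x' : G.Face → ℤ} (h : G.IsPotential D₀ f₀ D x) (h' : G.IsPotential D₀ f₀ D' x')
    {f : G.Face} (hf : G.subFaceOf {e | ¬ G.IsRigid D₀ e} f = G.subFaceOf _ f₀) :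
    (x - x') f = 0 := by
  have hside : ∀ e, G.IsRigid D₀ e →
      (x - x') (G.leftFace (e, true)) = (x - x') (G.leftFace (e, false)) := fun e he => by
    have h₁ := h.flow_sub h' e
    have h₂ := he D D' ((G.homologous_darts_iff_exists_isPotential _ _ f₀).2 ⟨x, h⟩)
      ((G.homologous_darts_iff_exists_isPotential _ _ f₀).2 ⟨x', h'⟩)
    rw [flow_darts, flow_darts, h₂, sub_self] at h₁
    linarith
  -- The difference of the potentials does not jump across rigid edges, so it descends to the merged
  -- faces.
  let q : G.SubFace {e | ¬ G.IsRigid D₀ e} → ℤ := Quot.lift (x - x') (by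
    rintro _ _ ⟨⟨e, b⟩, hd, rfl, rfl⟩
    have he := hside e (not_not.1 hd)
    cases b
    · exact he.symm
    · exact he)
  calc (x - x') f = (x - x') f₀ := congrArg q hf
    _ = 0 := by simp [h.1, h'.1]

/-- The edge of a dart `d` on the special boundary can be reversed within the homology class. This
raises the potential on the right of `d` if `d` is directed as in `D`, and lowers it otherwise. -/
theorem exists_potential_lt_of_mem_specialBoundary [Finite E] {D : EdgeOrientation E}
    {x : G.Face → ℤ} (h : G.IsPotential D₀ f₀ D x) {d : E × Bool}
    (hd : d ∈ G.specialBoundary D₀ f₀) :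
    ∃ D' x', G.IsPotential D₀ f₀ D' x' ∧
      (D d.1 = d.2 → x (G.leftFace (rev d)) < x' (G.leftFace (rev d))) ∧
      (D d.1 ≠ d.2 → x' (G.leftFace (rev d)) < x (G.leftFace (rev d))) := by
  obtain ⟨hS, hface⟩ := hd
  obtain ⟨D', hD', hne⟩ : ∃ D', G.Homologous (flow (darts D')) (flow (darts D₀)) ∧
      D' d.1 ≠ D d.1 := by
    by_contra! hcon
    exact hS fun D₁ D₂ h₁ h₂ => (hcon D₁ h₁).trans (hcon D₂ h₂).symm
  obtain ⟨x', h'⟩ := (G.homologous_darts_iff_exists_isPotential _ _ f₀).1 hD'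
  have hzero := h.eq_zero_of_subFaceOf_eq h' hface
  have hflow := h.flow_sub h' d.1
  refine ⟨D', x', h', ?_⟩
  obtain ⟨e, b⟩ := d
  have hr : ∀ b, (rev (e, b) : E × Bool) = (e, !b) := fun b => rfl
  simp only [flow_darts, Pi.sub_apply] at hflow hzero hne ⊢
  cases b <;> cases hDe : D e <;> cases hDe' : D' e <;>
    simp_all <;> omega

end SurfaceMap

open SurfaceMap in
theorem proposition4p13 {E : Type*} [Finite E] (G : SurfaceMap E)
    (D₀ : SurfaceMap.EdgeOrientation E) (f₀ : G.Face) :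
    (∃! Dmax : G.HomologousOrientations D₀ f₀, IsTop Dmax) ∧
    (∃! Dmin : G.HomologousOrientations D₀ f₀, IsBot Dmin) ∧
    (∀ Dmax : G.HomologousOrientations D₀ f₀, IsTop Dmax →
      G.specialBoundary D₀ f₀ ⊆ SurfaceMap.darts Dmax.1) ∧
    (∀ Dmin : G.HomologousOrientations D₀ f₀, IsBot Dmin →
      SurfaceMap.reverse (G.specialBoundary D₀ f₀) ⊆ SurfaceMap.darts Dmin.1) := by
  have hmem := fun D => G.homologous_darts_iff_exists_isPotential D₀ D f₀
  choose pot hpot using fun D : G.HomologousOrientations D₀ f₀ => (hmem D.1).1 D.2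
  have hle : ∀ D D' : G.HomologousOrientations D₀ f₀, D ≤ D' ↔ pot D' ≤ pot D :=
    fun D D' => isCounterclockwise_diff_iff (hpot D) (hpot D')
  have hlift : ∀ D x, G.IsPotential D₀ f₀ D x →
      ∃ D' : G.HomologousOrientations D₀ f₀, D'.1 = D ∧ pot D' = x := by
    intro D x hx
    refine ⟨⟨D, (hmem D).2 ⟨x, hx⟩⟩, rfl, ?_⟩
    have h := hpot ⟨D, (hmem D).2 ⟨x, hx⟩⟩
    -- Uniqueness of the potential: both inequalities are equivalent to the same statement about
    -- `darts D \ darts D`.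
    exact le_antisymm ((isCounterclockwise_diff_iff hx h).1 ((isCounterclockwise_diff_iff h h).2
      le_rfl)) ((isCounterclockwise_diff_iff h hx).1 ((isCounterclockwise_diff_iff h h).2 le_rfl))
  have hinj : Function.Injective pot := fun D D' h => Subtype.ext <| flow_darts_injective <| by
    funext e
    have h₁ := (hpot D).2 e
    rw [h, ← (hpot D').2 e] at h₁
    exact sub_left_injective h₁
  have : Finite (G.HomologousOrientations D₀ f₀) :=
    inferInstanceAs (Finite {D : EdgeOrientation E // _})
  have : Nonempty (G.HomologousOrientations D₀ f₀) :=
    ⟨⟨D₀, (hmem D₀).2 ⟨0, rfl, by simp⟩⟩⟩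
  have hdir : Directed (· ≤ ·) pot := fun D D' => by
    obtain ⟨D₁, h₁⟩ := (hpot D).exists_inf_or_sup (hpot D') (Or.inr rfl)
    obtain ⟨D₂, -, h₂⟩ := hlift _ _ h₁
    exact ⟨D₂, h₂ ▸ le_sup_left, h₂ ▸ le_sup_right⟩
  have hdir' : Directed (· ≥ ·) pot := fun D D' => by
    obtain ⟨D₁, h₁⟩ := (hpot D).exists_inf_or_sup (hpot D') (Or.inl rfl)
    obtain ⟨D₂, -, h₂⟩ := hlift _ _ h₁
    exact ⟨D₂, h₂ ▸ inf_le_left, h₂ ▸ inf_le_right⟩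
  -- The order is reversed: the top orientation has the least potential.
  obtain ⟨Dtop, htop⟩ := hdir'.finite_le id
  obtain ⟨Dbot, hbot⟩ := hdir.finite_le id
  refine ⟨⟨Dtop, fun D => (hle _ _).2 (htop D), fun D hD => hinj ?_⟩,
    ⟨Dbot, fun D => (hle _ _).2 (hbot D), fun D hD => hinj ?_⟩, fun D hD d hd => ?_,
    fun D hD d hd => ?_⟩
  · exact le_antisymm ((hle _ _).1 (hD _)) (htop D)
  · exact le_antisymm (hbot D) ((hle _ _).1 (hD _))
  · obtain ⟨D', x', hx', -, hlt⟩ := exists_potential_lt_of_mem_specialBoundary (hpot D) hd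
    obtain ⟨D'', -, rfl⟩ := hlift _ _ hx'
    -- A wrongly directed boundary edge could be reversed, giving a potential smaller somewhere than
    -- the least one.
    by_contra hcon
    exact (hlt hcon).not_ge ((hle _ _).1 (hD D'') _)
  · obtain ⟨D', x', hx', hlt, -⟩ := exists_potential_lt_of_mem_specialBoundary (hpot D) hd
    obtain ⟨D'', -, rfl⟩ := hlift _ _ hx'
    by_contra hcon
    refine (hlt ?_).not_ge ((hle _ _).1 (hD D'') _)
    obtain ⟨e, b⟩ := d
    have hcon' : ¬ D.1 e = b := hcon
    change D.1 e = !b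
    cases hb : D.1 e <;> cases b <;> simp_all
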